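/- **Conventions.** For infinite cardinals $\nu,\lambda$ let $S_\nu(\lambda)=\{x\subseteq\lambda : |x|<\nu\}$. A set $X\subseteq S_\nu(\lambda)$ is cofinal if every $x\in S_\nu(\lambda)$ is contained in some $y\in X$, and $\operatorname{cf}S_\nu(\lambda)$ is the least cardinality of a cofinal $X\subseteq S_\nu(\lambda)$. An ultrafilter over $\lambda$ is uniform if all its members have cardinality $\lambda$; an ultrafilter $D$ over $I$ is $\mu$-decomposable if there is $f:I\to\mu$ such that the image ultrafilter $f(D)$ is uniform over $\mu$. **The relation $\lambda\stackrel{\kappa}{\Rightarrow}\mu$.** Let $\lambda\ge\mu$ be infinite cardinals and $\kappa\ge\sup\{\operatorname{cf}S_\lambda(\lambda),\operatorname{cf}S_\mu(\mu)\}$. Then $\lambda\stackrel{\kappa}{\Rightarrow}\mu$ means: for some cofinal sets $V\subseteq S_\lambda(\lambda)$, $W\subseteq S_\mu(\mu)$ of cardinality $\le\kappa$, the first-order model $\mathfrak A'=\langle\lambda,R,R_v\rangle_{v\in V\cup W}$, where $R(\gamma)$ iff $\gamma<\mu$ and $R_v(\gamma)$ iff $\gamma\in v$, has an expansion $\mathfrak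 A$ by at most $\kappa$ new symbols such that, whenever $\mathfrak B$ is an elementary extension of $\mathfrak A$ having an element $x$ with $\mathfrak B\models\neg R_v(x)$ for all $v\in V$, then $\mathfrak B$ has an element $y$ with $\mathfrak B\models R(y)$ and $\mathfrak B\models\neg R_w(y)$ for all $w\in W$. **Regular logics.** A logic $\mathcal L$ assigns to every (one-sorted) vocabulary $\tau$ a class $\mathcal L[\tau]$ of sentences, with a satisfaction relation between nonempty $\tau$-structures and sentences in $\mathcal L[\tau]$ which is invariant under isomorphism and under inclusion and renaming of vocabularies (if $i:\sigma\to\tau$ is an arity-preserving injection, then for each $\varphi\in\mathcal L[\sigma]$ there is $\psi\in\mathcal L[\tau]$ such that a $\tau$-structure satisfies $\psi$ iff its $\sigma$-reduct along $i$ satisfies $\varphi$). It is regular if it contains all atomic first-order sentences, is closed under negation, conjunction and particularization (for $\varphi\in\mathcal L[\tau\cup\{c\}]$, with $c\notin\tau$ a constant symbol, some $\psi\in\mathcal L[\tau]$ holds in $\mathfrak A$ iff $(\mathfrak A,a)\models\varphi$ for some $a\in A$), and permits relativization (for $\sigma\subseteq\tau$, $\varphi\in\mathcal L[\sigma]$ and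 $\chi\in\mathcal L[\tau\cup\{c\}]$ there is $\psi\in\mathcal L[\tau]$ such that, for every $\tau$-structure $\mathfrak A$ in which $U=\{a:(\mathfrak A,a)\models\chi\}$ is nonempty and closed under the constants and functions of $\sigma$, $\mathfrak A\models\psi$ iff the substructure of $\mathfrak A|_\sigma$ with domain $U$ satisfies $\varphi$) and substitution (if to every relation symbol of $\sigma$, and to the graph of every function or constant symbol of $\sigma$, there is assigned an $\mathcal L$-formula over $\tau$ of the right number of arguments, then for each $\varphi\in\mathcal L[\sigma]$ there is $\psi\in\mathcal L[\tau]$ such that, for every $\tau$-structure $\mathfrak A$ in which the formulas assigned to function and constant symbols define graphs of total functions, $\mathfrak A\models\psi$ iff the $\sigma$-structure on $A$ defined by these formulas satisfies $\varphi$). **Compactness.** Let $V\subseteq S_\lambda(\lambda)$ be cofinal, and consider the following condition on a set $\Sigma$ of sentences of $\mathcal L$ and a family $(\varphi_v)_{v\in V}$ of sentences of $\mathcal L$: if $\Sigma\cup\{\varphi_v : v\in V,\ \gamma\notin v\}$ has a model for every $\gamma\in\lambda$, then $\Sigma\cup\{\varphi_v : v\in V\}$ has a model. If $|V|\le\kappa$,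 the logic $\mathcal L$ is $\kappa$-$(\lambda)$-compact (relative to $V$) if the condition holds for all $(\varphi_v)_{v\in V}$ and all sets $\Sigma$ with $|\Sigma|\le\kappa$; it is $[\lambda]$-compact (relative to $V$) if it holds for all $(\varphi_v)_{v\in V}$ and all sets $\Sigma$, without any bound on $|\Sigma|$ (nor on $|V|$). **Proposition.** Let $\lambda\ge\mu$ be infinite cardinals and $\kappa\ge\sup\{\operatorname{cf}S_\lambda(\lambda),\operatorname{cf}S_\mu(\mu)\}$. 1. If $\lambda\stackrel{\kappa}{\Rightarrow}\mu$, then every $\kappa$-$(\lambda)$-compact regular logic is $\kappa$-$(\mu)$-compact, whatever cofinal sets of cardinality $\le\kappa$ are used for the two compactness properties. 2. If every ultrafilter uniform over $\lambda$ is $\mu$-decomposable, then every $[\lambda]$-compact regular logic is $[\mu]$-compact, whatever cofinal sets are used. -/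

import Mathlib

open FirstOrder Cardinal

universe u w

/-- `S_ν(λ)`: the subsets of (the underlying set of) the cardinal `λ` of cardinality `< ν`. -/
def SmallSubsets (ν lam : Cardinal.{u}) : Set (Set lam.ord.ToType) :=
  {x | #x < ν}

/-- `X` is a cofinal subset of `S_ν(λ)`. -/
def CofinalInSmall (ν lam : Cardinal.{u}) (X : Set (Set lam.ord.ToType)) : Prop :=
  X ⊆ SmallSubsets ν lam ∧ ∀ x ∈ SmallSubsets ν lam, ∃ y ∈ X, x ⊆ y

/-- `cf S_ν(λ)`: the least cardinality of a cofinal subset of `S_ν(λ)`. -/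
noncomputable def cfSmall (ν lam : Cardinal.{u}) : Cardinal.{u} :=
  sInf {c | ∃ X : Set (Set lam.ord.ToType), CofinalInSmall ν lam X ∧ #X = c}

/-- An ultrafilter over `λ` is uniform if all its members have cardinality `λ`. -/
def UniformOver (lam : Cardinal.{u}) (D : Ultrafilter lam.ord.ToType) : Prop :=
  ∀ s ∈ D, #s = lam

/-- An ultrafilter over `I` is `μ`-decomposable if some `f : I → μ` maps it to an ultrafilter
uniform over `μ`. -/
def Decomposable {I : Type u} (mu : Cardinal.{u}) (D : Ultrafilter I) : Prop :=
  ∃ f : I → mu.ord.ToType, UniformOver mu (D.map f)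

/-! ### The relation `λ ⇒^κ μ` -/

/-- The unary relation symbols `R` and `R_v` (`v ∈ I`). -/
inductive BaseRel (I : Type u) : ℕ → Type u
  | R : BaseRel I 1
  | mem (v : I) : BaseRel I 1

/-- The language `{R} ∪ {R_v : v ∈ I}`. -/
def baseLang (I : Type u) : FirstOrder.Language.{u, u} :=
  ⟨fun _ => PEmpty, BaseRel I⟩

/-- The inclusion of `μ` into `λ ≥ μ`, as sets of ordinals. -/
noncomputable def inclOrd {lam mu : Cardinal.{u}} (h : mu ≤ lam) (α : mu.ord.ToType) :
    lam.ord.ToType :=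
  Ordinal.ToType.mk ⟨α.toOrd.1, (Set.mem_Iio.1 α.toOrd.2).trans_le (ord_le_ord.2 h)⟩

/-- The copy inside `λ ≥ μ` of a family of subsets of `μ`. -/
noncomputable def inLarger {lam mu : Cardinal.{u}} (h : mu ≤ lam)
    (W : Set (Set mu.ord.ToType)) : Set (Set lam.ord.ToType) :=
  (fun w => inclOrd h '' w) '' W

/-- The model `𝔄' = ⟨λ, R, R_v⟩_{v ∈ I}`: `R` is the initial segment `μ` of `λ`, and `R_v` is `v`. -/
@[reducible] noncomputable def baseStructure {lam mu : Cardinal.{u}} (h : mu ≤ lam)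
    (I : Set (Set lam.ord.ToType)) : (baseLang I).Structure lam.ord.ToType where
  funMap f := f.elim
  RelMap r := match r with
    | .R => fun x => x 0 ∈ Set.range (inclOrd h)
    | .mem v => fun x => x 0 ∈ v.1

/-- The expansion `(𝔄', N)` of `𝔄'` by the interpretation `S` of a language `N` of new symbols is
such that every elementary extension `𝔅` with an element outside all `R_v` (`v ∈ V`) has an
element in `R` outside all `R_w` (`w ∈ W`). -/
def ExpansionWitnesses {lam mu : Cardinal.{u}} (h : mu ≤ lam)
    (V : Set (Set lam.ord.ToType)) (W : Set (Set mu.ord.ToType))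
    (N : FirstOrder.Language.{u, u}) (S : N.Structure lam.ord.ToType) : Prop :=
  letI := baseStructure h (V ∪ inLarger h W)
  letI := S
  ∀ (B : Type u) [((baseLang ↥(V ∪ inLarger h W)).sum N).Structure B],
    Nonempty (lam.ord.ToType ↪ₑ[(baseLang ↥(V ∪ inLarger h W)).sum N] B) →
    let R : B → Prop := fun b =>
      FirstOrder.Language.Structure.RelMap (L := (baseLang ↥(V ∪ inLarger h W)).sum N)
        (Sum.inl BaseRel.R) ![b]
    let Rmem : ↥(V ∪ inLarger h W) → B → Prop := fun v b =>
      FirstOrder.Language.Structure.RelMap (L := (baseLang ↥(V ∪ inLarger h W)).sum N)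
        (Sum.inl (BaseRel.mem v)) ![b]
    (∃ x : B, ∀ v, v.1 ∈ V → ¬ Rmem v x) →
      ∃ y : B, R y ∧ ∀ v, v.1 ∈ inLarger h W → ¬ Rmem v y

/-- `λ ⇒^κ μ`: for some cofinal `V ⊆ S_λ(λ)` and `W ⊆ S_μ(μ)` of cardinality `≤ κ`, the model `𝔄'`
has an expansion by at most `κ` new symbols as in `ExpansionWitnesses`. -/
def ModelImplies (κ lam mu : Cardinal.{u}) (h : mu ≤ lam) : Prop :=
  ∃ (V : Set (Set lam.ord.ToType)) (W : Set (Set mu.ord.ToType)),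
    CofinalInSmall lam lam V ∧ #V ≤ κ ∧ CofinalInSmall mu mu W ∧ #W ≤ κ ∧
    ∃ (N : FirstOrder.Language.{u, u}) (S : N.Structure lam.ord.ToType),
      N.card ≤ κ ∧ ExpansionWitnesses h V W N S

/-! ### Abstract logics -/

/-- An abstract logic: sentences for each vocabulary, and a satisfaction relation between nonempty
structures and sentences, with the isomorphism property and the reduct and renaming properties
(the latter two combined: `σ` is included in or renamed into `τ` by an injective language map). The
sentences of a vocabulary may form a proper class, hence the separate universe `w`. -/
structure AbstractLogic where
  Sentence : FirstOrder.Language.{u, u} → Type w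
  Sat : ∀ {τ : FirstOrder.Language.{u, u}} (M : Type u) [τ.Structure M] [Nonempty M], Sentence τ → Prop
  sat_iso : ∀ {τ : FirstOrder.Language.{u, u}} (M N : Type u) [τ.Structure M] [Nonempty M]
    [τ.Structure N] [Nonempty N], Nonempty (M ≃[τ] N) →
    ∀ φ : Sentence τ, Sat M φ ↔ Sat N φ
  exists_rename : ∀ {σ τ : FirstOrder.Language.{u, u}} (i : σ →ᴸ τ), i.Injective → ∀ φ : Sentence σ,
    ∃ ψ : Sentence τ, ∀ (M : Type u) [τ.Structure M] [Nonempty M],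
      Sat M ψ ↔ (letI := i.reduct M; Sat M φ)

namespace AbstractLogic

variable (L : AbstractLogic.{u, w})

/-- `(M, a₁, …, aₙ) ⊨ χ`, where `χ` is a sentence of the vocabulary with `n` new constants. -/
def SatAt {τ : FirstOrder.Language.{u, u}} (M : Type u) [τ.Structure M] [Nonempty M] {n : ℕ}
    (χ : L.Sentence (τ[[Fin n]])) (a : Fin n → M) : Prop :=
  letI := FirstOrder.Language.constantsOn.structure a
  L.Sat M χ

/-- A logic is regular if it has the atom, negation, conjunction, particularization,
relativization and substitution properties. -/
structure IsRegular : Prop where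
  atom : ∀ {τ : FirstOrder.Language.{u, u}} (θ : τ.Sentence), θ.IsAtomic →
    ∃ ψ : L.Sentence τ, ∀ (M : Type u) [τ.Structure M] [Nonempty M], L.Sat M ψ ↔ M ⊨ θ
  neg : ∀ {τ : FirstOrder.Language.{u, u}} (φ : L.Sentence τ),
    ∃ ψ : L.Sentence τ, ∀ (M : Type u) [τ.Structure M] [Nonempty M], L.Sat M ψ ↔ ¬ L.Sat M φ
  conj : ∀ {τ : FirstOrder.Language.{u, u}} (φ₁ φ₂ : L.Sentence τ),
    ∃ ψ : L.Sentence τ, ∀ (M : Type u) [τ.Structure M] [Nonempty M],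
      L.Sat M ψ ↔ L.Sat M φ₁ ∧ L.Sat M φ₂
  particularization : ∀ {τ : FirstOrder.Language.{u, u}} (φ : L.Sentence (τ[[Fin 1]])),
    ∃ ψ : L.Sentence τ, ∀ (M : Type u) [τ.Structure M] [Nonempty M],
      L.Sat M ψ ↔ ∃ a : M, L.SatAt M φ ![a]
  /-- `ψ` says that `φ` holds in the substructure defined by `χ`, whenever `χ` defines a nonempty
  set closed under the operations in the vocabulary `σ` of `φ`. -/
  relativization : ∀ {σ τ : FirstOrder.Language.{u, u}} (i : σ →ᴸ τ), i.Injective →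
    ∀ (φ : L.Sentence σ) (χ : L.Sentence (τ[[Fin 1]])),
    ∃ ψ : L.Sentence τ, ∀ (M : Type u) [τ.Structure M] [Nonempty M],
      letI := i.reduct M
      ∀ (U : σ.Substructure M) [Nonempty U], (∀ a : M, a ∈ U ↔ L.SatAt M χ ![a]) →
        (L.Sat M ψ ↔ L.Sat U φ)
  /-- The symbols of `σ` may be replaced by formulas over `τ`: `ψ` says that `φ` holds in the
  `σ`-structure whose relations, and whose graphs of operations, are defined by these formulas,
  whenever the formulas for the operations do define graphs of operations. -/
  substitution : ∀ {σ τ : FirstOrder.Language.{u, u}} (χR : ∀ n, σ.Relations n → L.Sentence (τ[[Fin n]]))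
    (χF : ∀ n, σ.Functions n → L.Sentence (τ[[Fin (n + 1)]])) (φ : L.Sentence σ),
    ∃ ψ : L.Sentence τ, ∀ (M : Type u) [τ.Structure M] [Nonempty M] [σ.Structure M],
      (∀ (n : ℕ) (r : σ.Relations n) (x : Fin n → M),
        FirstOrder.Language.Structure.RelMap r x ↔ L.SatAt M (χR n r) x) →
      (∀ (n : ℕ) (f : σ.Functions n) (x : Fin n → M) (y : M),
        FirstOrder.Language.Structure.funMap f x = y ↔ L.SatAt M (χF n f) (Fin.snoc x y)) →
      (L.Sat M ψ ↔ L.Sat M φ)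

/-- The set `Γ` of sentences has a model. -/
def HasModel {τ : FirstOrder.Language.{u, u}} (Γ : Set (L.Sentence τ)) : Prop :=
  ∃ (M : Type u) (_ : τ.Structure M) (_ : Nonempty M), ∀ φ ∈ Γ, L.Sat M φ

/-- The conclusion of `λ`-compactness, relative to `V`, for one set `Γ` and one family `φ`: if
`Γ ∪ {φ_v : γ ∉ v}` has a model for every `γ ∈ λ`, then `Γ ∪ {φ_v : v ∈ V}` has a model. -/
def CompactFor {τ : FirstOrder.Language.{u, u}} {lam : Cardinal.{u}} (V : Set (Set lam.ord.ToType))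
    (Γ : Set (L.Sentence τ)) (φ : V → L.Sentence τ) : Prop :=
  (∀ γ : lam.ord.ToType, L.HasModel (Γ ∪ {θ | ∃ v : V, γ ∉ v.1 ∧ φ v = θ})) →
    L.HasModel (Γ ∪ Set.range φ)

/-- `κ`-`(λ)`-compactness, relative to the fixed cofinal set `V`. -/
def KCompact (κ : Cardinal.{u}) {lam : Cardinal.{u}} (V : Set (Set lam.ord.ToType)) : Prop :=
  ∀ (τ : FirstOrder.Language.{u, u}) (Γ : Set (L.Sentence τ)) (φ : V → L.Sentence τ),
    lift.{u} #Γ ≤ lift.{w} κ → L.CompactFor V Γ φ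

/-- `[λ]`-compactness, relative to the fixed cofinal set `V`: `Γ` may be any set of sentences
(as opposed to a proper class). -/
def BoxCompact {lam : Cardinal.{u}} (V : Set (Set lam.ord.ToType)) : Prop :=
  ∀ (τ : FirstOrder.Language.{u, u}) (Γ : Set (L.Sentence τ)) (φ : V → L.Sentence τ),
    Small.{u} Γ → L.CompactFor V Γ φ

end AbstractLogic

/-!
Let `𝔄` be an expansion as in the definition of `λ ⇒^κ μ`, and for every `γ ∈ μ` let `M_γ` be a
model of `Σ` and of the sentences `φ_w` with `γ ∉ w`. Glue these models to a bundle with base `𝔄`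
and fiber `M_γ` over `γ`. In a regular logic a sentence about the fiber over `z` is a formula in
`z`, so at most `κ` sentences say that the base satisfies the elementary diagram of `𝔄`, that the
fibers satisfy `Σ`, and that the fibers over the points of `R` outside `R_w` satisfy `φ_w`. By
`κ`-`(λ)`-compactness there is such a bundle with a point of the base outside all `R_v`. The base
is an elementary extension of `𝔄`, hence it has a point of `R` outside all `R_w`, and the fiber
over this point is a model of `Σ` and of all `φ_w`.

If all uniform ultrafilters over `λ` are `μ`-decomposable, the expansion by all self-maps and all
subsets of `λ` witnesses `λ ⇒^κ μ` for large `κ`: an element `x` outside all `R_v` determines the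
uniform ultrafilter of the sets whose symbols it satisfies, and a map that decomposes the
ultrafilter sends `x` to an element of `R` outside all `R_w`.
-/

open FirstOrder.Language FirstOrder.Language.Structure

/-! ### Definability in a regular logic -/

theorem snoc_default {M : Type*} (a : M) : (Fin.snoc default a : Fin 1 → M) = ![a] :=
  funext fun i => by fin_cases i; rfl

section LanguageMaps

variable {τ : FirstOrder.Language.{u, u}} {α : Type*}

/-- The language map that interprets the constants indexed by `α` as given constants of `τ`. -/
def lhomOfConstants (c : α → τ.Constants) : constantsOn α →ᴸ τ where
  onFunction {n} f := match n, f with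
    | 0, f => c f
  onRelation {_} r := r.elim

theorem lhomOfConstants_isExpansionOn {M : Type*} [τ.Structure M] (c : α → τ.Constants)
    (a : α → M) (h : ∀ i, (c i : M) = a i) :
    letI := constantsOn.structure a
    (lhomOfConstants c).IsExpansionOn M :=
  letI := constantsOn.structure a
  { map_onFunction := fun {n} f x => match n, f with
      | 0, f => (congrArg (funMap (c f)) (Subsingleton.elim x default)).trans (h f)
    map_onRelation := fun {_} r => r.elim }

theorem isAtomic_equivSentence {φ : τ.Formula α} (hφ : BoundedFormula.IsAtomic φ) :
    BoundedFormula.IsAtomic (Formula.equivSentence φ) := by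
  cases hφ with
  | equal s t => exact .equal _ _
  | rel r ts => exact .rel _ _

end LanguageMaps

namespace AbstractLogic

variable {L : AbstractLogic.{u, w}} {σ τ : FirstOrder.Language.{u, u}} {n : ℕ}

/-- `C` is the class of models of a single sentence of the logic `L`. -/
def IsElementaryClass (L : AbstractLogic.{u, w}) (τ : FirstOrder.Language.{u, u})
    (C : ∀ (M : Type u) [τ.Structure M] [Nonempty M], Prop) : Prop :=
  ∃ ψ : L.Sentence τ, ∀ (M : Type u) [τ.Structure M] [Nonempty M], L.Sat M ψ ↔ C M

/-- The `n`-ary predicate `P` on `τ`-structures is defined by a formula of the logic `L`, that is,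
by a sentence with `n` new constants. -/
def Definable (L : AbstractLogic.{u, w}) (τ : FirstOrder.Language.{u, u}) (n : ℕ)
    (P : ∀ (M : Type u) [τ.Structure M] [Nonempty M], (Fin n → M) → Prop) : Prop :=
  ∃ χ : L.Sentence (τ[[Fin n]]), ∀ (M : Type u) [τ.Structure M] [Nonempty M] (a : Fin n → M),
    L.SatAt M χ a ↔ P M a

section IsElementaryClass

variable {C D : ∀ (M : Type u) [τ.Structure M] [Nonempty M], Prop}

theorem isElementaryClass_sat (φ : L.Sentence τ) : L.IsElementaryClass τ fun M _ _ => L.Sat M φ :=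
  ⟨φ, fun _ _ _ => Iff.rfl⟩

theorem IsElementaryClass.congr (hC : L.IsElementaryClass τ C)
    (h : ∀ (M : Type u) [τ.Structure M] [Nonempty M], C M ↔ D M) : L.IsElementaryClass τ D := by
  obtain ⟨ψ, hψ⟩ := hC
  exact ⟨ψ, fun M _ _ => (hψ M).trans (h M)⟩

theorem IsElementaryClass.not (hL : L.IsRegular) (hC : L.IsElementaryClass τ C) :
    L.IsElementaryClass τ fun M _ _ => ¬ C M := by
  obtain ⟨φ, hφ⟩ := hC
  obtain ⟨ψ, hψ⟩ := hL.neg φ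
  exact ⟨ψ, fun M _ _ => (hψ M).trans (not_congr (hφ M))⟩

theorem IsElementaryClass.and (hL : L.IsRegular) (hC : L.IsElementaryClass τ C)
    (hD : L.IsElementaryClass τ D) : L.IsElementaryClass τ fun M _ _ => C M ∧ D M := by
  obtain ⟨φ, hφ⟩ := hC
  obtain ⟨φ', hφ'⟩ := hD
  obtain ⟨ψ, hψ⟩ := hL.conj φ φ'
  exact ⟨ψ, fun M _ _ => (hψ M).trans (and_congr (hφ M) (hφ' M))⟩

theorem IsElementaryClass.imp (hL : L.IsRegular) (hC : L.IsElementaryClass τ C)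
    (hD : L.IsElementaryClass τ D) : L.IsElementaryClass τ fun M _ _ => C M → D M :=
  ((hC.and hL (hD.not hL)).not hL).congr fun _ _ _ => by tauto

end IsElementaryClass

namespace Definable

variable {P Q : ∀ (M : Type u) [τ.Structure M] [Nonempty M], (Fin n → M) → Prop}

theorem congr (hP : L.Definable τ n P)
    (h : ∀ (M : Type u) [τ.Structure M] [Nonempty M] (a : Fin n → M), P M a ↔ Q M a) :
    L.Definable τ n Q := by
  obtain ⟨χ, hχ⟩ := hP
  exact ⟨χ, fun M _ _ a => (hχ M a).trans (h M a)⟩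

theorem not (hL : L.IsRegular) (hP : L.Definable τ n P) :
    L.Definable τ n fun M _ _ a => ¬ P M a := by
  obtain ⟨χ, hχ⟩ := hP
  obtain ⟨ψ, hψ⟩ := hL.neg χ
  refine ⟨ψ, fun M _ _ a => ?_⟩
  let := constantsOn.structure a
  exact (hψ M).trans (not_congr (hχ M a))

theorem and (hL : L.IsRegular) (hP : L.Definable τ n P) (hQ : L.Definable τ n Q) :
    L.Definable τ n fun M _ _ a => P M a ∧ Q M a := by
  obtain ⟨χ, hχ⟩ := hP
  obtain ⟨χ', hχ'⟩ := hQ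
  obtain ⟨ψ, hψ⟩ := hL.conj χ χ'
  refine ⟨ψ, fun M _ _ a => ?_⟩
  let := constantsOn.structure a
  exact (hψ M).trans (and_congr (hχ M a) (hχ' M a))

theorem imp (hL : L.IsRegular) (hP : L.Definable τ n P) (hQ : L.Definable τ n Q) :
    L.Definable τ n fun M _ _ a => P M a → Q M a :=
  ((hP.and hL (hQ.not hL)).not hL).congr fun _ _ _ _ => by tauto

theorem of_isAtomic (hL : L.IsRegular) {φ : τ.Formula (Fin n)} (hφ : BoundedFormula.IsAtomic φ) :
    L.Definable τ n fun _ _ _ a => φ.Realize a := by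
  obtain ⟨ψ, hψ⟩ := hL.atom (Formula.equivSentence φ) (isAtomic_equivSentence hφ)
  refine ⟨ψ, fun M _ _ a => ?_⟩
  let := constantsOn.structure a
  exact (hψ M).trans (Formula.realize_equivSentence M φ)

end Definable

/-- Substitution makes renaming available for language maps that are not injective, such as those
that identify constants. -/
theorem IsRegular.exists_transfer (hL : L.IsRegular) (i : σ →ᴸ τ)
    (φ : L.Sentence σ) :
    ∃ ψ : L.Sentence τ, ∀ (M : Type u) [σ.Structure M] [τ.Structure M] [Nonempty M]
      [i.IsExpansionOn M], L.Sat M ψ ↔ L.Sat M φ := by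
  choose χR hχR using fun (n : ℕ) (r : σ.Relations n) =>
    Definable.of_isAtomic hL (φ := (i.onRelation r).formula Term.var) (.rel _ _)
  choose χF hχF using fun (n : ℕ) (f : σ.Functions n) =>
    Definable.of_isAtomic hL
      (φ := Term.equal (Term.func (i.onFunction f) fun j => Term.var j.castSucc)
        (Term.var (Fin.last n))) (.equal _ _)
  obtain ⟨ψ, hψ⟩ := hL.substitution χR χF φ
  refine ⟨ψ, fun M _ _ _ _ => hψ M (fun n r x => ?_) fun n f x y => ?_⟩
  · refine Iff.trans ?_ (hχR n r M x).symm
    simp only [Formula.realize_rel, Term.realize_var, i.map_onRelation]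
  · refine Iff.trans ?_ (hχF n f M _).symm
    simp only [Formula.realize_equal, Term.realize_func, Term.realize_var, Fin.snoc_castSucc,
      Fin.snoc_last, i.map_onFunction]

namespace Definable

theorem ex (hL : L.IsRegular)
    {P : ∀ (M : Type u) [τ.Structure M] [Nonempty M], (Fin (n + 1) → M) → Prop}
    (hP : L.Definable τ (n + 1) P) :
    L.Definable τ n fun M _ _ a => ∃ b : M, P M (Fin.snoc a b) := by
  obtain ⟨χ, hχ⟩ := hP
  let c : Fin (n + 1) → ((τ[[Fin n]])[[Fin 1]]).Constants :=
    Fin.snoc (α := fun _ => _) (fun j => Sum.inl (τ.con j)) ((τ[[Fin n]]).con 0)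
  let i : τ →ᴸ (τ[[Fin n]])[[Fin 1]] := LHom.sumInl.comp LHom.sumInl
  obtain ⟨χ', hχ'⟩ := hL.exists_transfer (i.sumElim (lhomOfConstants c)) χ
  obtain ⟨ψ, hψ⟩ := hL.particularization χ'
  refine ⟨ψ, fun M _ _ a => ?_⟩
  let := constantsOn.structure a
  refine (hψ M).trans (exists_congr fun b => ?_)
  rw [← hχ]
  let := constantsOn.structure ![b]
  have hc : ∀ j, (c j : M) = Fin.snoc (α := fun _ => M) a b j := by
    refine Fin.lastCases ?_ fun j => ?_
    · rw [show c (Fin.last n) = (τ[[Fin n]]).con 0 from Fin.snoc_last .., Fin.snoc_last]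
      rfl
    · rw [show c j.castSucc = Sum.inl (τ.con j) from Fin.snoc_castSucc .., Fin.snoc_castSucc]
      rfl
  let := constantsOn.structure (Fin.snoc (α := fun _ => M) a b)
  have := lhomOfConstants_isExpansionOn c _ hc
  have : i.IsExpansionOn M := ⟨fun _ _ => rfl, fun _ _ => rfl⟩
  have := LHom.sumElim_isExpansionOn i (lhomOfConstants c) M
  exact hχ' M

theorem all (hL : L.IsRegular)
    {P : ∀ (M : Type u) [τ.Structure M] [Nonempty M], (Fin (n + 1) → M) → Prop}
    (hP : L.Definable τ (n + 1) P) :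
    L.Definable τ n fun M _ _ a => ∀ b : M, P M (Fin.snoc a b) :=
  (((hP.not hL).ex hL).not hL).congr fun _ _ _ _ => by push Not; rfl

theorem isElementaryClass (hL : L.IsRegular)
    {P : ∀ (M : Type u) [τ.Structure M] [Nonempty M], (Fin 0 → M) → Prop} (hP : L.Definable τ 0 P) :
    L.IsElementaryClass τ fun M _ _ => P M default := by
  obtain ⟨χ, hχ⟩ := hP
  obtain ⟨ψ, hψ⟩ := hL.exists_transfer (LEquiv.addEmptyConstants τ (Fin 0)).invLHom χ
  refine ⟨ψ, fun M _ _ => ?_⟩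
  let := constantsOn.structure (default : Fin 0 → M)
  have : (LEquiv.addEmptyConstants τ (Fin 0)).invLHom.IsExpansionOn M :=
    LHom.sumElim_isExpansionOn _ _ M
  exact (hψ M).trans (hχ M default)

theorem forall_isElementaryClass (hL : L.IsRegular)
    {P : ∀ (M : Type u) [τ.Structure M] [Nonempty M], (Fin 1 → M) → Prop} (hP : L.Definable τ 1 P) :
    L.IsElementaryClass τ fun M _ _ => ∀ a : M, P M ![a] :=
  ((hP.all hL).isElementaryClass hL).congr fun M _ _ => forall_congr' fun a => by
    rw [snoc_default]

theorem boundedFormula (hL : L.IsRegular) (φ : τ.BoundedFormula Empty n) :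
    L.Definable τ n fun _ _ _ a => φ.Realize default a := by
  have realize_relabel : ∀ {k : ℕ} {M : Type u} [τ.Structure M] (a : Fin k → M)
      (t : τ.Term (Empty ⊕ Fin k)),
      (t.relabel (Sum.elim Empty.elim id)).realize a = t.realize (Sum.elim default a) := by
    intro k M _ a t
    rw [Term.realize_relabel]
    congr 1
    exact funext (Sum.rec (fun i => i.elim) fun _ => rfl)
  induction φ with
  | @falsum n =>
    let x : τ.Term (Fin (n + 1)) := Term.var (Fin.last n)
    have exists_eq_self := (of_isAtomic hL (φ := x.equal x) (.equal _ _)).ex hL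
    refine (exists_eq_self.not hL).congr fun M _ _ a => ?_
    simp only [Formula.realize_equal, exists_const, not_true_eq_false, BoundedFormula.Realize]
  | equal s t =>
    refine (of_isAtomic hL (φ := (s.relabel (Sum.elim Empty.elim id)).equal
      (t.relabel (Sum.elim Empty.elim id))) (.equal _ _)).congr fun M _ _ a => ?_
    simp only [Formula.realize_equal, realize_relabel, BoundedFormula.Realize]
  | rel r ts =>
    refine (of_isAtomic hL (φ := r.formula fun j => (ts j).relabel (Sum.elim Empty.elim id))
      (.rel _ _)).congr fun M _ _ a => ?_
    simp only [Formula.realize_rel, realize_relabel, BoundedFormula.Realize]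
  | imp _ _ h₁ h₂ => exact h₁.imp hL h₂
  | all _ h => exact h.all hL

theorem formula (hL : L.IsRegular) (φ : τ.Formula (Fin n)) :
    L.Definable τ n fun _ _ _ a => φ.Realize a :=
  have relabel_definable :=
    boundedFormula hL (BoundedFormula.relabel (n := n) (Sum.inr : Fin n → Empty ⊕ Fin n) φ)
  relabel_definable.congr fun M _ _ a => by
    rw [BoundedFormula.realize_relabel, Formula.Realize,
      Subsingleton.elim (default : Fin 0 → M) (a ∘ Fin.natAdd n)]
    rfl

end Definable

theorem IsRegular.isElementaryClass_models (hL : L.IsRegular) (θ : τ.Sentence) :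
    L.IsElementaryClass τ fun M _ _ => M ⊨ θ :=
  (Definable.boundedFormula hL θ).isElementaryClass hL

end AbstractLogic

/-! ### Guarded interpretations -/

section RelLang

variable (ι : Type u) (n : ℕ)

/-- The symbols of `relLang`. -/
inductive NaryRel : ℕ → Type u
  | rel (i : ι) : NaryRel n

/-- The language whose only symbols are `n`-ary relation symbols indexed by `ι`. -/
def relLang : FirstOrder.Language.{u, u} :=
  ⟨fun _ => PEmpty, NaryRel ι n⟩

variable {ι n}

/-- The `relLang ι n`-structure in which the symbol `i` denotes `P i`. -/
@[reducible] def relStructure {M : Type u} (P : ι → (Fin n → M) → Prop) :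
    (relLang ι n).Structure M where
  funMap f := f.elim
  RelMap | .rel i => P i

end RelLang

/-- An interpretation of `σ` in `τ`: in every `τ`-structure `M` it defines the `σ`-structure whose
domain is defined by `dom`, together with the extra element `point`, and whose operations and
relations are given by terms and formulas. The values of the terms outside the domain are replaced
by `point`. This makes the domain nonempty and closed under the operations in every `M`, so no
axioms have to be spent on it: the vocabulary `σ` may have more than `κ` symbols. -/
structure Interpretation (σ τ : FirstOrder.Language.{u, u}) where
  dom : τ.Formula (Fin 1)
  point : τ.Constants
  fn : ∀ {n}, σ.Functions n → τ.Term (Fin n)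
  rel : ∀ {n}, σ.Relations n → τ.Formula (Fin n)

namespace Interpretation

variable {σ τ : FirstOrder.Language.{u, u}} (I : Interpretation σ τ) {n : ℕ}

/-- The formula defining the domain of the interpretation, including the extra element. -/
def mem : τ.Formula (Fin 1) :=
  I.dom ⊔ (Term.var 0).equal I.point.term

/-- The formula defining the graph of the guarded operation `f`. -/
def graph (f : σ.Functions n) : τ.Formula (Fin (n + 1)) :=
  let value : τ.Term (Fin (n + 1)) := (I.fn f).relabel Fin.castSucc
  let valueMem : τ.Formula (Fin (n + 1)) := I.mem.subst ![value]
  (valueMem.imp (value.equal (Term.var (Fin.last n)))) ⊓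
    (valueMem.not.imp (I.point.term.equal (Term.var (Fin.last n))))

variable (M : Type u) [τ.Structure M]

open Classical in
/-- The guarded operations and the relations of the interpretation, on all of `M`. -/
@[reducible] noncomputable def structureOn : σ.Structure M where
  funMap f x := if I.mem.Realize ![(I.fn f).realize x] then (I.fn f).realize x else I.point
  RelMap r x := (I.rel r).Realize x

variable {M} in
theorem realize_mem (x : M) : I.mem.Realize ![x] ↔ I.dom.Realize ![x] ∨ x = I.point := by
  simp [mem, Formula.realize_sup, Formula.realize_equal]

/-- The structure defined by the interpretation, as a substructure of `structureOn`. -/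
def substructure :
    letI := I.structureOn M
    σ.Substructure M :=
  letI := I.structureOn M
  { carrier := {x | I.mem.Realize ![x]}
    fun_mem := fun {n} f x _ => by
      classical
      change I.mem.Realize ![ite _ _ _]
      split_ifs with h
      exacts [h, (I.realize_mem _).2 (.inr rfl)] }

/-- The domain of the structure defined by the interpretation. -/
def Carrier : Type u :=
  {x : M // I.mem.Realize ![x]}

noncomputable instance carrierStructure : σ.Structure (I.Carrier M) :=
  letI := I.structureOn M
  inferInstanceAs (σ.Structure (I.substructure M))

instance nonempty_carrier : Nonempty (I.Carrier M) :=
  ⟨⟨I.point, (I.realize_mem _).2 (.inr rfl)⟩⟩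

variable {M}

theorem realize_graph (f : σ.Functions n) (x : Fin n → M) (y : M) :
    letI := I.structureOn M
    (I.graph f).Realize (Fin.snoc x y) ↔ funMap f x = y := by
  have realize_value : ((I.fn f).relabel Fin.castSucc).realize (Fin.snoc x y : Fin (n + 1) → M) =
      (I.fn f).realize x := by
    rw [Term.realize_relabel]
    exact congrArg (fun v => (I.fn f).realize v)
      (funext fun i => Fin.snoc_castSucc (α := fun _ => M) y x i)
  have realize_valueMem : Formula.Realize (I.mem.subst ![(I.fn f).relabel Fin.castSucc])
      (Fin.snoc x y : Fin (n + 1) → M) ↔ I.mem.Realize ![(I.fn f).realize x] := by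
    rw [Formula.Realize, BoundedFormula.realize_subst, ← realize_value]
    exact iff_of_eq (congrArg (fun v => I.mem.Realize v) (funext fun i => by fin_cases i; rfl))
  simp only [graph, Formula.realize_inf, Formula.realize_imp, Formula.realize_not,
    Formula.realize_equal, realize_value, realize_valueMem, Term.realize_var, Fin.snoc_last,
    Term.realize_constants]
  classical exact (ite_eq_iff' ..).symm

theorem nonempty_equiv_carrier {N : Type u} [σ.Structure N] (e : N → M)
    (he : Function.Injective e) (hmem : ∀ x, I.mem.Realize ![x] ↔ x ∈ Set.range e)
    (hfn : ∀ {n} (f : σ.Functions n) (x : Fin n → N), (I.fn f).realize (e ∘ x) = e (funMap f x))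
    (hrel : ∀ {n} (r : σ.Relations n) (x : Fin n → N), (I.rel r).Realize (e ∘ x) ↔ RelMap r x) :
    Nonempty (N ≃[σ] I.Carrier M) := by
  let eN : N ≃ I.Carrier M :=
    (Equiv.ofInjective e he).trans (Equiv.subtypeEquivRight fun x => (hmem x).symm)
  refine ⟨⟨eN, fun f x => Subtype.ext ?_, fun r x => hrel r x⟩⟩
  have value_mem : I.mem.Realize ![(I.fn f).realize (e ∘ x)] := (hmem _).2 ⟨_, (hfn f x).symm⟩
  exact ((if_pos value_mem).trans (hfn f x)).symm

end Interpretation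

namespace AbstractLogic

variable {L : AbstractLogic.{u, w}} {σ τ : FirstOrder.Language.{u, u}}

theorem IsElementaryClass.carrier (hL : L.IsRegular) (I : Interpretation σ τ)
    {C : ∀ (M : Type u) [σ.Structure M] [Nonempty M], Prop} (hC : L.IsElementaryClass σ C) :
    L.IsElementaryClass τ fun M _ _ => C (I.Carrier M) := by
  obtain ⟨φ, hφ⟩ := hC
  let σ' := σ.sum (relLang PUnit 1)
  let isMem : σ'.Formula (Fin 1) := Relations.formula (L := σ') (.inr (.rel .unit)) Term.var
  obtain ⟨χ, hχ⟩ := Definable.formula hL isMem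
  obtain ⟨φ', hφ'⟩ := hL.relativization (LHom.sumInl : σ →ᴸ σ') LHom.sumInl_injective φ χ
  choose χf hχf using fun (n : ℕ) (φ : τ.Formula (Fin n)) => Definable.formula hL φ
  obtain ⟨ψ, hψ⟩ := hL.substitution (σ := σ') (τ := τ)
    (fun n r => match n, r with
      | n, .inl r => χf n (I.rel r)
      | _, .inr (.rel _) => χf 1 I.mem)
    (fun n f => match f with
      | .inl f => χf (n + 1) (I.graph f)
      | .inr f => f.elim) φ'
  refine ⟨ψ, fun M _ _ => ?_⟩
  let := I.structureOn M
  let : (relLang PUnit 1).Structure M := relStructure fun _ x => I.mem.Realize x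
  have : Nonempty (I.substructure M) := inferInstanceAs (Nonempty (I.Carrier M))
  refine ((hψ M ?_ ?_).trans (hφ' M (I.substructure M) fun a => (hχ M ![a]).symm)).trans
    (hφ (I.Carrier M))
  · rintro n (r | ⟨⟨⟩⟩) x
    · exact (hχf n _ M x).symm
    · exact (hχf 1 _ M x).symm
  · rintro n (f | f) x y
    · exact (I.realize_graph f x y).symm.trans (hχf _ _ M _).symm
    · exact f.elim

end AbstractLogic

/-! ### Compactness along a relation -/

namespace AbstractLogic

variable {L : AbstractLogic.{u, w}} {σ τ : FirstOrder.Language.{u, u}} {κ : Cardinal.{u}}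

theorem IsElementaryClass.reduct {i : σ →ᴸ τ} (hi : i.Injective)
    {C : ∀ (M : Type u) [σ.Structure M] [Nonempty M], Prop} (hC : L.IsElementaryClass σ C) :
    L.IsElementaryClass τ fun M _ _ => letI := i.reduct M; C M := by
  obtain ⟨φ, hφ⟩ := hC
  obtain ⟨ψ, hψ⟩ := L.exists_rename i hi φ
  refine ⟨ψ, fun M _ _ => ?_⟩
  let := i.reduct M
  exact (hψ M).trans (hφ M)

theorem IsElementaryClass.iff_of_equiv
    {C : ∀ (M : Type u) [τ.Structure M] [Nonempty M], Prop} (hC : L.IsElementaryClass τ C)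
    {M N : Type u} [τ.Structure M] [Nonempty M] [τ.Structure N] [Nonempty N]
    (e : Nonempty (M ≃[τ] N)) : C M ↔ C N := by
  obtain ⟨ψ, hψ⟩ := hC
  rw [← hψ M, ← hψ N, L.sat_iso M N e]

/-- `C` is the class of models of at most `κ` sentences of the logic `L`. -/
def IsAxiomatizable (L : AbstractLogic.{u, w}) (κ : Cardinal.{u}) (τ : FirstOrder.Language.{u, u})
    (C : ∀ (M : Type u) [τ.Structure M] [Nonempty M], Prop) : Prop :=
  ∃ Γ : Set (L.Sentence τ), lift.{u} #Γ ≤ lift.{w} κ ∧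
    ∀ (M : Type u) [τ.Structure M] [Nonempty M], (∀ θ ∈ Γ, L.Sat M θ) ↔ C M

theorem isAxiomatizable_forall.{v} {ι : Type v} (hι : lift.{u} #ι ≤ lift.{v} κ)
    {C : ι → ∀ (M : Type u) [τ.Structure M] [Nonempty M], Prop}
    (hC : ∀ i, L.IsElementaryClass τ (C i)) :
    L.IsAxiomatizable κ τ fun M _ _ => ∀ i, C i M := by
  choose ψ hψ using hC
  refine ⟨Set.range ψ, ?_, fun M _ _ => Set.forall_mem_range.trans (forall_congr' fun i => hψ i M)⟩
  refine lift_le.{v}.1 ?_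
  have card_range_le := lift_le.{u}.2 (mk_range_le_lift (f := ψ))
  have card_index_le := lift_le.{w}.2 hι
  simp only [lift_lift] at card_range_le card_index_le ⊢
  exact card_range_le.trans card_index_le

theorem IsAxiomatizable.and (hκ : ℵ₀ ≤ κ)
    {C D : ∀ (M : Type u) [τ.Structure M] [Nonempty M], Prop} (hC : L.IsAxiomatizable κ τ C)
    (hD : L.IsAxiomatizable κ τ D) : L.IsAxiomatizable κ τ fun M _ _ => C M ∧ D M := by
  obtain ⟨Γ, hΓ, hΓC⟩ := hC
  obtain ⟨Δ, hΔ, hΔD⟩ := hD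
  refine ⟨Γ ∪ Δ, ?_, fun M _ _ => ?_⟩
  · refine (lift_le.2 (mk_union_le Γ Δ)).trans ?_
    rw [lift_add]
    exact add_le_of_le (aleph0_le_lift.2 hκ) hΓ hΔ
  · simp only [Set.mem_union, or_imp, forall_and]
    exact and_congr (hΓC M) (hΔD M)

theorem IsAxiomatizable.iff_of_equiv
    {C : ∀ (M : Type u) [τ.Structure M] [Nonempty M], Prop} (hC : L.IsAxiomatizable κ τ C)
    {M N : Type u} [τ.Structure M] [Nonempty M] [τ.Structure N] [Nonempty N]
    (e : Nonempty (M ≃[τ] N)) : C M ↔ C N := by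
  obtain ⟨Γ, -, hΓ⟩ := hC
  rw [← hΓ M, ← hΓ N]
  exact forall₂_congr fun θ _ => L.sat_iso M N e θ

theorem IsAxiomatizable.reduct {i : σ →ᴸ τ} (hi : i.Injective)
    {C : ∀ (M : Type u) [σ.Structure M] [Nonempty M], Prop} (hC : L.IsAxiomatizable κ σ C) :
    L.IsAxiomatizable κ τ fun M _ _ => letI := i.reduct M; C M := by
  obtain ⟨Γ, hΓ, hΓC⟩ := hC
  obtain ⟨Δ, hΔ, hΔC⟩ := isAxiomatizable_forall hΓ fun θ : Γ =>
    (isElementaryClass_sat θ.1).reduct hi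
  refine ⟨Δ, hΔ, fun M _ _ => (hΔC M).trans ?_⟩
  let := i.reduct M
  exact Subtype.forall.trans (hΓC M)

/-- The compactness property of the paper, with the relation `γ ∉ v` between `v ∈ V` and `γ ∈ λ`
replaced by an arbitrary relation `out`: if for every `a` there is a structure in `C` that belongs
to `E j` whenever `out j a`, then there is one that belongs to all the classes `E j`. -/
def KCompactAlong (L : AbstractLogic.{u, w}) (κ : Cardinal.{u}) {J A : Type u}
    (out : J → A → Prop) : Prop :=
  ∀ (τ : FirstOrder.Language.{u, u}) (C : ∀ (M : Type u) [τ.Structure M] [Nonempty M], Prop)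
    (E : J → ∀ (M : Type u) [τ.Structure M] [Nonempty M], Prop),
    L.IsAxiomatizable κ τ C → (∀ j, L.IsElementaryClass τ (E j)) →
    (∀ a, ∃ (M : Type u) (_ : τ.Structure M) (_ : Nonempty M), C M ∧ ∀ j, out j a → E j M) →
    ∃ (M : Type u) (_ : τ.Structure M) (_ : Nonempty M), C M ∧ ∀ j, E j M

theorem hasModel_union_iff (Γ Δ : Set (L.Sentence τ)) :
    L.HasModel (Γ ∪ Δ) ↔ ∃ (M : Type u) (_ : τ.Structure M) (_ : Nonempty M),
      (∀ θ ∈ Γ, L.Sat M θ) ∧ ∀ θ ∈ Δ, L.Sat M θ := by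
  simp only [HasModel, Set.mem_union, or_imp, forall_and]

theorem kCompact_iff_kCompactAlong {lam : Cardinal.{u}} {V : Set (Set lam.ord.ToType)} :
    L.KCompact κ V ↔ L.KCompactAlong κ fun (v : V) γ => γ ∉ v.1 := by
  simp only [KCompact, CompactFor, hasModel_union_iff, Set.forall_mem_range]
  constructor
  · rintro h τ C E ⟨Γ, hΓ, hΓC⟩ hE hM
    choose φ hφ using hE
    simp only [← hΓC, ← hφ] at hM ⊢
    refine h τ Γ φ hΓ fun γ => ?_
    obtain ⟨M, _, _, hMΓ, hMφ⟩ := hM γ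
    exact ⟨M, _, ‹_›, hMΓ, fun θ ⟨v, hv, hθ⟩ => hθ ▸ hMφ v hv⟩
  · intro h τ Γ φ hΓ hM
    refine h τ _ _ ⟨Γ, hΓ, fun M _ _ => Iff.rfl⟩ (fun v => isElementaryClass_sat (φ v)) fun γ => ?_
    obtain ⟨M, _, _, hMΓ, hMφ⟩ := hM γ
    exact ⟨M, _, ‹_›, hMΓ, fun v hv => hMφ _ ⟨v, hv, rfl⟩⟩

/-- In particular, compactness does not depend on the choice of a cofinal set. The propositional
symbols `flag j` let one member of the family handle all the classes `E j'` with `f j' = j`. -/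
theorem KCompactAlong.mono (hL : L.IsRegular) (hκ : ℵ₀ ≤ κ) {J J' A A' : Type u} (hJ' : #J' ≤ κ)
    {out : J → A → Prop} {out' : J' → A' → Prop} (hc : L.KCompactAlong κ out) (f : J' → J)
    (g : A → A') (hfg : ∀ j' a, out (f j') a → out' j' (g a)) : L.KCompactAlong κ out' := by
  intro τ C E hC hE hM
  let τ' := τ.sum (relLang J 0)
  let flag (j : J) : τ'.Sentence := Relations.formula (L := τ') (.inr (.rel j)) default
  have hinl : (LHom.sumInl : τ →ᴸ τ').Injective := LHom.sumInl_injective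
  obtain ⟨N, hNs, hN, ⟨hNC, hNE⟩, hflag⟩ := hc τ' _ (fun j M _ _ => M ⊨ flag j)
    ((hC.reduct hinl).and hκ (isAxiomatizable_forall (ι := J') (lift_le.2 hJ') fun j' =>
      (hL.isElementaryClass_models (flag (f j'))).imp hL ((hE j').reduct hinl)))
    (fun j => hL.isElementaryClass_models (flag j)) fun a => by
      obtain ⟨M, _, _, hMC, hME⟩ := hM (g a)
      let : (relLang J 0).Structure M := relStructure fun j _ => out j a
      have realize_flag : ∀ j, M ⊨ flag j ↔ out j a := fun j => Iff.rfl
      exact ⟨M, inferInstance, inferInstance, ⟨hMC, fun j' h =>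
        hME j' (hfg j' a ((realize_flag _).1 h))⟩, fun j => (realize_flag j).2⟩
  let := (LHom.sumInl : τ →ᴸ τ').reduct N
  exact ⟨N, inferInstance, hN, hNC, fun j' => hNE j' (hflag (f j'))⟩

end AbstractLogic

/-! ### Bundles of structures -/

theorem realize_cons {τ : FirstOrder.Language.{u, u}} {M : Type u} [τ.Structure M] {α : Type*}
    {n : ℕ} (v : α → M) (t : τ.Term α) (ts : Fin n → τ.Term α) :
    (fun i => (Fin.cons (α := fun _ => τ.Term α) t ts i).realize v) =
      Fin.cons (α := fun _ => M) (t.realize v) fun i => (ts i).realize v :=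
  funext <| Fin.cases rfl fun _ => rfl

/-- The operation symbols of `bundleLang`. -/
inductive BundleFn (τ : FirstOrder.Language.{u, u}) : ℕ → Type u
  | point : BundleFn τ 0
  | proj : BundleFn τ 1
  | op {n : ℕ} (f : τ.Functions n) : BundleFn τ (n + 1)

/-- The relation symbols of `bundleLang`. -/
inductive BundleRel (τ : FirstOrder.Language.{u, u}) : ℕ → Type u
  | rel {n : ℕ} (r : τ.Relations n) : BundleRel τ (n + 1)

/-- The language of bundles of `τ`-structures. A bundle lives on its total space, the base is
identified with the image of a section, and `proj` is the idempotent map of the total space onto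
this image. The symbols of `τ` have an additional first argument, which determines the fiber, and
`point` is a distinguished element of the base. -/
def bundleLang (τ : FirstOrder.Language.{u, u}) : FirstOrder.Language.{u, u} :=
  ⟨BundleFn τ, BundleRel τ⟩

section BundleInterpretations

variable (K τ : FirstOrder.Language.{u, u}) {n : ℕ}

/-- The symbol for the distinguished point of a bundle, next to the symbols of `K`. -/
def bundlePoint : (K.sum (bundleLang τ)).Constants := .inr BundleFn.point

/-- The symbol for the projection of a bundle, next to the symbols of `K`. -/
def bundleProj : (K.sum (bundleLang τ)).Functions 1 := .inr BundleFn.proj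

variable {τ} in
/-- The operation symbol `f` of the fibers of a bundle, next to the symbols of `K`. -/
def bundleOp (f : τ.Functions n) : (K.sum (bundleLang τ)).Functions (n + 1) := .inr (.op f)

variable {τ} in
/-- The relation symbol `r` of the fibers of a bundle, next to the symbols of `K`. -/
def bundleRel (r : τ.Relations n) : (K.sum (bundleLang τ)).Relations (n + 1) := .inr (.rel r)

variable {K} in
/-- The relation symbol `r` of the base of a bundle, next to the symbols of the fibers. -/
def bundleBaseRel (r : K.Relations n) : (K.sum (bundleLang τ)).Relations n := .inl r

/-- The base of a bundle, as a structure for the language `K`. -/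
def baseInterpretation : Interpretation K (K.sum (bundleLang τ)) where
  dom := ((bundleProj K τ).apply₁ (.var 0)).equal (.var 0)
  point := bundlePoint K τ
  fn f := Term.func (LHom.sumInl.onFunction f) .var
  rel r := (bundleBaseRel τ r).formula .var

/-- The fiber of a bundle that contains the element denoted by the new constant. -/
def fiberInterpretation : Interpretation τ ((K.sum (bundleLang τ))[[Fin 1]]) where
  dom := (((lhomWithConstants _ _).onFunction (bundleProj K τ)).apply₁ (.var 0)).equal
    (((lhomWithConstants _ _).onFunction (bundleProj K τ)).apply₁
      ((K.sum (bundleLang τ)).con 0).term)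
  point := (K.sum (bundleLang τ)).con 0
  fn f := Term.func ((lhomWithConstants _ _).onFunction (bundleOp K f))
    (Fin.cons ((K.sum (bundleLang τ)).con 0).term .var)
  rel r := ((lhomWithConstants _ _).onRelation (bundleRel K r)).formula
    (Fin.cons ((K.sum (bundleLang τ)).con 0).term .var)

variable {K τ} {D : Type u} [(K.sum (bundleLang τ)).Structure D]

theorem realize_baseInterpretation_dom (x : D) :
    (baseInterpretation K τ).dom.Realize ![x] ↔ funMap (bundleProj K τ) ![x] = x := by
  rw [baseInterpretation, Formula.realize_equal, Term.realize_functions_apply₁]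
  rfl

theorem realize_fiberInterpretation_dom (z x : D) :
    letI := constantsOn.structure ![z]
    (fiberInterpretation K τ).dom.Realize ![x] ↔
      funMap (bundleProj K τ) ![x] = funMap (bundleProj K τ) ![z] := by
  let := constantsOn.structure ![z]
  rw [fiberInterpretation, Formula.realize_equal, Term.realize_functions_apply₁,
    Term.realize_functions_apply₁, Term.realize_constants]
  rfl

theorem realize_fiberInterpretation_fn (f : τ.Functions n) (z : D) (x : Fin n → D) :
    letI := constantsOn.structure ![z]
    ((fiberInterpretation K τ).fn f).realize x =
      funMap (bundleOp K f) (Fin.cons (α := fun _ => D) z x) := by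
  let := constantsOn.structure ![z]
  rw [fiberInterpretation, Term.realize_func, realize_cons, Term.realize_constants]
  rfl

theorem realize_fiberInterpretation_rel (r : τ.Relations n) (z : D) (x : Fin n → D) :
    letI := constantsOn.structure ![z]
    ((fiberInterpretation K τ).rel r).Realize x ↔
      RelMap (bundleRel K r) (Fin.cons (α := fun _ => D) z x) := by
  let := constantsOn.structure ![z]
  rw [fiberInterpretation, Formula.realize_rel, realize_cons, Term.realize_constants]
  rfl

theorem relMap_baseInterpretation_carrier (r : K.Relations 1)
    (x : (baseInterpretation K τ).Carrier D) :
    RelMap r ![x] ↔ RelMap (bundleBaseRel τ r) ![x.1] :=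
  Formula.realize_rel.trans <|
    iff_of_eq <| congrArg (RelMap (bundleBaseRel τ r)) <| funext fun i => by fin_cases i; rfl

variable (K τ) (D) in
/-- The fiber of the bundle `D` that contains the only entry of `z`. -/
abbrev BundleFiber (z : Fin 1 → D) : Type u :=
  letI := constantsOn.structure z
  (fiberInterpretation K τ).Carrier D

end BundleInterpretations

section TotalSpace

variable {A : Type u} (M : A → Type u) [∀ a, Nonempty (M a)]

/-- The section of the total space that represents the base. -/
noncomputable def bundleSection (a : A) : Σ a, M a :=
  ⟨a, Classical.arbitrary _⟩

variable {M} in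
open Classical in
/-- The coordinate in the fiber over `a`, with an arbitrary value outside this fiber. -/
noncomputable def fiberCoord (a : A) (z : Σ a, M a) : M a :=
  if h : z.1 = a then h ▸ z.2 else Classical.arbitrary _

theorem fiberCoord_mk (a : A) (m : M a) : fiberCoord a ⟨a, m⟩ = m :=
  dif_pos rfl

/-- The total space of a family of `τ`-structures, as a bundle with the distinguished point `c`. -/
@[reducible] noncomputable def totalStructure (τ : FirstOrder.Language.{u, u})
    [∀ a, τ.Structure (M a)] (c : A) : (bundleLang τ).Structure (Σ a, M a) where
  funMap
    | .point => fun _ => bundleSection M c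
    | .proj => fun x => bundleSection M (x 0).1
    | .op f => fun x => ⟨(x 0).1, funMap f (fiberCoord (x 0).1 ∘ Fin.tail x)⟩
  RelMap
    | .rel r => fun x => RelMap r (fiberCoord (x 0).1 ∘ Fin.tail x)

/-- The structure of the base, pulled back to the total space. -/
@[reducible] noncomputable def pullbackStructure (K : FirstOrder.Language.{u, u})
    [K.Structure A] : K.Structure (Σ a, M a) where
  funMap f x := bundleSection M (funMap f (Sigma.fst ∘ x))
  RelMap r x := RelMap r (Sigma.fst ∘ x)

variable (K τ : FirstOrder.Language.{u, u}) [K.Structure A] [∀ a, τ.Structure (M a)] (c : A)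

theorem relMap_pullbackStructure (r : K.Relations 1) (z : Σ a, M a) :
    letI := pullbackStructure M K
    RelMap r ![z] ↔ RelMap r ![z.1] := by
  have fst_comp : Sigma.fst ∘ ![z] = ![z.1] := funext fun i => by fin_cases i; rfl
  exact iff_of_eq (congrArg (RelMap r) fst_comp)

theorem nonempty_equiv_base :
    letI := pullbackStructure M K
    letI := totalStructure M τ c
    Nonempty (A ≃[K] (baseInterpretation K τ).Carrier (Σ a, M a)) := by
  let := pullbackStructure M K
  let := totalStructure M τ c
  refine (baseInterpretation K τ).nonempty_equiv_carrier (bundleSection M)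
    (fun _ _ h => congrArg Sigma.fst h) (fun x => ?_) (fun f x => rfl) fun r x => Iff.rfl
  rw [Interpretation.realize_mem, realize_baseInterpretation_dom]
  constructor
  · rintro (h | h)
    exacts [⟨_, h⟩, ⟨c, h.symm⟩]
  · rintro ⟨a, rfl⟩
    exact .inl rfl

theorem nonempty_equiv_fiber (z : Σ a, M a) :
    letI := pullbackStructure M K
    letI := totalStructure M τ c
    Nonempty (M z.1 ≃[τ] BundleFiber K τ (Σ a, M a) ![z]) := by
  let := pullbackStructure M K
  let := totalStructure M τ c
  let := constantsOn.structure ![z]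
  have fiberCoord_comp : ∀ {n} (x : Fin n → M z.1), fiberCoord z.1 ∘ (Sigma.mk z.1 ∘ x) = x :=
    fun x => funext fun i => fiberCoord_mk M z.1 (x i)
  refine (fiberInterpretation K τ).nonempty_equiv_carrier (Sigma.mk z.1)
    sigma_mk_injective (fun x => ?_) (fun f x => ?_) fun r x => ?_
  · rw [Interpretation.realize_mem, realize_fiberInterpretation_dom]
    constructor
    · rintro (h | h)
      · have fst_eq : x.1 = z.1 :=
          (congrArg Sigma.fst (show bundleSection M x.1 = bundleSection M z.1 from h) :)
        exact ⟨fst_eq ▸ x.2, Sigma.ext fst_eq.symm (by simp)⟩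
      · exact ⟨z.2, h.symm⟩
    · rintro ⟨m, rfl⟩
      exact .inl rfl
  · rw [realize_fiberInterpretation_fn]
    exact congrArg (fun y => (⟨z.1, funMap f y⟩ : Σ a, M a)) (fiberCoord_comp x)
  · rw [realize_fiberInterpretation_rel]
    exact iff_of_eq (congrArg (RelMap r) (fiberCoord_comp x))

end TotalSpace

namespace AbstractLogic

variable {L : AbstractLogic.{u, w}} {κ : Cardinal.{u}} {τ : FirstOrder.Language.{u, u}}
  {C : ∀ (M : Type u) [τ.Structure M] [Nonempty M], Prop}

theorem IsElementaryClass.fiber (hL : L.IsRegular) (K : FirstOrder.Language.{u, u})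
    (hC : L.IsElementaryClass τ C) :
    L.Definable (K.sum (bundleLang τ)) 1 fun D _ _ z => C (BundleFiber K τ D z) := by
  obtain ⟨χ, hχ⟩ := hC.carrier hL (fiberInterpretation K τ)
  refine ⟨χ, fun D _ _ z => ?_⟩
  let := constantsOn.structure z
  exact hχ D

theorem IsAxiomatizable.forall_fiber (hL : L.IsRegular) (K : FirstOrder.Language.{u, u})
    (hC : L.IsAxiomatizable κ τ C) :
    L.IsAxiomatizable κ (K.sum (bundleLang τ)) fun D _ _ =>
      ∀ z : D, C (BundleFiber K τ D ![z]) := by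
  obtain ⟨Γ, hΓ, hΓC⟩ := hC
  obtain ⟨Δ, hΔ, hΔC⟩ := isAxiomatizable_forall hΓ fun θ : Γ =>
    ((isElementaryClass_sat θ.1).fiber hL K).forall_isElementaryClass hL
  refine ⟨Δ, hΔ, fun D _ _ => (hΔC D).trans ?_⟩
  exact forall_comm.trans <| forall_congr' fun z => Subtype.forall.trans (hΓC _)

end AbstractLogic

section ElementaryExtension

variable {κ : Cardinal.{u}} {K τ : FirstOrder.Language.{u, u}} {A I J : Type u} [K.Structure A]

theorem mk_elementaryDiagram_le (hκ : ℵ₀ ≤ κ) (hK : K.card ≤ κ) (hA : #A ≤ κ) :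
    #(K.elementaryDiagram A) ≤ κ := by
  have card_withConstants_le : (K[[A]]).card ≤ κ := by
    rw [card_withConstants, lift_id, lift_id]
    exact add_le_of_le hκ hK hA
  calc #(K.elementaryDiagram A) ≤ #((K[[A]]).Sentence) := mk_subtype_le _
    _ ≤ #(Σ n, (K[[A]]).BoundedFormula Empty n) := mk_le_of_injective (sigma_mk_injective (i := 0))
    _ ≤ κ := BoundedFormula.card_le.trans (max_le hκ (by simpa using card_withConstants_le))

/-- Every elementary extension of `A` with an element outside all `v i` has an element in `R` and
outside all `w j`. With `A` the expansion of the model `𝔄'` of the paper this is the condition in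
the definition of `λ ⇒^κ μ`. -/
def ExtensionsRealize (K : FirstOrder.Language.{u, u}) (A : Type u) [K.Structure A]
    (v : I → K.Relations 1) (R : K.Relations 1) (w : J → K.Relations 1) : Prop :=
  ∀ (B : Type u) [K.Structure B], Nonempty (A ↪ₑ[K] B) →
    (∃ x : B, ∀ i, ¬ RelMap (v i) ![x]) → ∃ y : B, RelMap R ![y] ∧ ∀ j, ¬ RelMap (w j) ![y]

/-- The symbol `r` of `K`, in the language of bundles over elementary extensions of `A`. -/
def diagramRel (A : Type u) (τ : FirstOrder.Language.{u, u}) (r : K.Relations 1) :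
    ((K[[A]]).sum (bundleLang τ)).Relations 1 :=
  bundleBaseRel τ (K := K[[A]]) (.inl r)

theorem ExtensionsRealize.exists_base_point {v : I → K.Relations 1} {R : K.Relations 1}
    {w : J → K.Relations 1} (hext : ExtensionsRealize K A v R w)
    {D : Type u} [((K[[A]]).sum (bundleLang τ)).Structure D]
    (hbase : (baseInterpretation (K[[A]]) τ).Carrier D ⊨ K.elementaryDiagram A)
    (hpoint : ∀ i, ¬ RelMap (diagramRel A τ (v i)) ![(bundlePoint (K[[A]]) τ : D)]) :
    ∃ y : D, RelMap (diagramRel A τ R) ![y] ∧ ∀ j, ¬ RelMap (diagramRel A τ (w j)) ![y] := by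
  let U := (baseInterpretation (K[[A]]) τ).Carrier D
  let : K.Structure U := (K.lhomWithConstants A).reduct U
  have : (K.lhomWithConstants A).IsExpansionOn U := LHom.isExpansionOn_reduct _ _
  have relMap_iff (r : K.Relations 1) (x : U) :
      RelMap r ![x] ↔ RelMap (diagramRel A τ r) ![x.1] :=
    relMap_baseInterpretation_carrier (K := K[[A]]) (.inl r) x
  let x : U := ⟨bundlePoint (K[[A]]) τ, (Interpretation.realize_mem _ _).2 (.inr rfl)⟩
  obtain ⟨y, hyR, hyw⟩ := hext U ⟨ElementaryEmbedding.ofModelsElementaryDiagram K A U⟩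
    ⟨x, fun i hi => hpoint i ((relMap_iff (v i) x).1 hi)⟩
  exact ⟨y.1, (relMap_iff R y).1 hyR, fun j h => hyw j ((relMap_iff (w j) y).2 h)⟩

end ElementaryExtension

namespace AbstractLogic

variable {L : AbstractLogic.{u, w}} {κ : Cardinal.{u}} {τ : FirstOrder.Language.{u, u}}

theorem Definable.relMap (hL : L.IsRegular) (r : τ.Relations n) :
    L.Definable τ n fun _ _ _ a => RelMap r a :=
  (of_isAtomic hL (φ := r.formula .var) (.rel _ _)).congr fun _ _ _ _ => Formula.realize_rel

theorem IsRegular.isElementaryClass_relMap_const (hL : L.IsRegular) (r : τ.Relations 1)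
    (c : τ.Constants) : L.IsElementaryClass τ fun M _ _ => RelMap r ![(c : M)] :=
  (hL.isElementaryClass_models (r.formula₁ c.term)).congr fun M _ _ => by
    rw [Sentence.Realize, Formula.realize_rel₁, Term.realize_constants]

/-- A model of the sentences describing the bundle of all the structures `M a` over `A`, in which
the distinguished point lies outside all `v i`, has an elementary extension of `A` as its base, and
the fiber over a point in `R` and outside all `w j` is the required structure. -/
theorem IsRegular.kCompactAlong_of_extensionsRealize (hL : L.IsRegular) (hκ : ℵ₀ ≤ κ)
    {A I J : Type u} {K : FirstOrder.Language.{u, u}} [K.Structure A]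
    (hA : #A ≤ κ) (hK : K.card ≤ κ) (hJ : #J ≤ κ)
    {v : I → K.Relations 1} {R : K.Relations 1} {w : J → K.Relations 1}
    (hext : ExtensionsRealize K A v R w)
    (hc : L.KCompactAlong κ fun i (a : A) => ¬ RelMap (v i) ![a]) :
    L.KCompactAlong κ fun j (a : A) => RelMap R ![a] ∧ ¬ RelMap (w j) ![a] := by
  intro τ C E hC hE hM
  choose M _ _ hMC hME using hM
  let Λ := (K[[A]]).sum (bundleLang τ)
  have base_axioms := isAxiomatizable_forall (L := L) (τ := Λ) (κ := κ)
    (lift_le.2 (mk_elementaryDiagram_le hκ hK hA)) fun θ : K.elementaryDiagram A =>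
      (hL.isElementaryClass_models θ.1).carrier hL (baseInterpretation (K[[A]]) τ)
  have fiber_axioms := hC.forall_fiber hL (K[[A]])
  have family_axioms := isAxiomatizable_forall (L := L) (τ := Λ) (κ := κ) (lift_le.2 hJ)
    fun j => ((Definable.relMap hL (diagramRel A τ R)).imp hL
      (((Definable.relMap hL (diagramRel A τ (w j))).not hL).imp hL
        ((hE j).fiber hL (K[[A]])))).forall_isElementaryClass hL
  obtain ⟨D, _, _, ⟨hDbase, hDC, hDE⟩, hDpoint⟩ := hc Λ _ _
    (base_axioms.and hκ (fiber_axioms.and hκ family_axioms))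
    (fun i => (hL.isElementaryClass_relMap_const (diagramRel A τ (v i))
      (bundlePoint (K[[A]]) τ)).not hL) fun c => by
      have : Nonempty A := ⟨c⟩
      let := pullbackStructure M (K[[A]])
      let := totalStructure M τ c
      have relMap_iff (r : K.Relations 1) (z : Σ a, M a) :
          RelMap (diagramRel A τ r) ![z] ↔ RelMap r ![z.1] :=
        relMap_pullbackStructure M (K[[A]]) (.inl r) z
      have equiv_fiber := nonempty_equiv_fiber M (K[[A]]) τ c
      refine ⟨Σ a, M a, inferInstance, ⟨bundleSection M c⟩,
        ⟨fun θ => ?_, fun z => ?_, fun j z hR hw => ?_⟩, fun i hi => ?_⟩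
      · exact ((hL.isElementaryClass_models θ.1).iff_of_equiv
          (nonempty_equiv_base M (K[[A]]) τ c)).1 θ.2
      · exact (hC.iff_of_equiv (equiv_fiber z)).1 (hMC z.1)
      · exact ((hE j).iff_of_equiv (equiv_fiber z)).1
          (hME z.1 j ⟨(relMap_iff R z).1 hR, fun h => hw ((relMap_iff (w j) z).2 h)⟩)
      · exact fun h => hi ((relMap_iff (v i) _).1 h)
  obtain ⟨y, hyR, hyw⟩ := hext.exists_base_point ⟨fun θ hθ => hDbase ⟨θ, hθ⟩⟩ hDpoint
  exact ⟨BundleFiber (K[[A]]) τ D ![y], inferInstance, inferInstance, hDC y, fun j =>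
    hDE j y hyR (hyw j)⟩

end AbstractLogic

/-! ### From expansions to compactness -/

theorem CofinalInSmall.le_mk {lam : Cardinal.{u}} {V : Set (Set lam.ord.ToType)}
    (hV : CofinalInSmall lam lam V) : lam ≤ #V := by
  by_contra! hlt
  have exists_notMem : ∀ v : V, ∃ x, x ∉ v.1 := fun v => by
    by_contra! hall
    have card_lt : #v.1 < lam := hV.1 v.2
    rw [Set.eq_univ_of_forall hall, mk_univ, mk_ord_toType] at card_lt
    exact card_lt.false
  choose x hx using exists_notMem
  obtain ⟨y, hy, hxy⟩ := hV.2 (Set.range x) (mk_range_le.trans_lt hlt)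
  exact hx ⟨y, hy⟩ (hxy ⟨⟨y, hy⟩, rfl⟩)

theorem card_baseLang_le {κ : Cardinal.{u}} (hκ : ℵ₀ ≤ κ) {I : Type u} (hI : #I ≤ κ) :
    (baseLang I).card ≤ κ := by
  let symbol : Option I → (baseLang I).Symbols := fun v => .inr ⟨1, v.elim .R .mem⟩
  have symbol_surjective : Function.Surjective symbol := by
    rintro (⟨_, f⟩ | ⟨_, _ | v⟩)
    exacts [f.elim, ⟨none, rfl⟩, ⟨some v, rfl⟩]
  refine (mk_le_of_surjective symbol_surjective).trans ?_
  rw [mk_option]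
  exact add_le_of_le hκ hI (one_le_aleph0.trans hκ)

theorem inclOrd_injective {lam mu : Cardinal.{u}} (h : mu ≤ lam) :
    Function.Injective (inclOrd h) := by
  intro a b hab
  have ordinal_eq := congrArg Subtype.val (Ordinal.ToType.mk.injective hab)
  exact Ordinal.ToType.mk.symm.injective (Subtype.ext ordinal_eq)

theorem ExpansionWitnesses.extensionsRealize {lam mu : Cardinal.{u}} {h : mu ≤ lam}
    {V : Set (Set lam.ord.ToType)} {W : Set (Set mu.ord.ToType)} {N : FirstOrder.Language.{u, u}}
    {S : N.Structure lam.ord.ToType} (hS : ExpansionWitnesses h V W N S) :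
    letI := baseStructure h (V ∪ inLarger h W)
    ExtensionsRealize ((baseLang ↥(V ∪ inLarger h W)).sum N) lam.ord.ToType
      (fun v : V => .inl (.mem ⟨v.1, .inl v.2⟩)) (.inl .R)
      fun w : W => .inl (.mem ⟨_, .inr ⟨w.1, w.2, rfl⟩⟩) := by
  rintro B _ hB ⟨x, hx⟩
  obtain ⟨y, hyR, hyW⟩ := hS B hB ⟨x, fun v hv => hx ⟨v.1, hv⟩⟩
  exact ⟨y, hyR, fun w => hyW _ ⟨w.1, w.2, rfl⟩⟩

namespace AbstractLogic

variable {L : AbstractLogic.{u, w}} {κ lam mu : Cardinal.{u}}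

theorem IsRegular.kCompact_of_modelImplies (hL : L.IsRegular) (hmu : ℵ₀ ≤ mu) (hle : mu ≤ lam)
    (h : ModelImplies κ lam mu hle)
    {V : Set (Set lam.ord.ToType)} (hV : CofinalInSmall lam lam V) (hc : L.KCompact κ V)
    {W : Set (Set mu.ord.ToType)} (hW : CofinalInSmall mu mu W) (hWκ : #W ≤ κ) :
    L.KCompact κ W := by
  obtain ⟨V₀, W₀, hV₀, hV₀κ, hW₀, hW₀κ, N, S, hN, hS⟩ := h
  have lam_le : lam ≤ κ := hV₀.le_mk.trans hV₀κ
  have hκ : ℵ₀ ≤ κ := (hmu.trans hle).trans lam_le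
  have card_lang_le : ((baseLang ↥(V₀ ∪ inLarger hle W₀)).sum N).card ≤ κ := by
    rw [card_sum, lift_id, lift_id]
    refine add_le_of_le hκ (card_baseLang_le hκ ?_) hN
    exact (mk_union_le _ _).trans (add_le_of_le hκ hV₀κ (mk_image_le.trans hW₀κ))
  have : Nonempty mu.ord.ToType := mk_ne_zero_iff.1 (by
    rw [mk_ord_toType]
    exact (aleph0_pos.trans_le hmu).ne')
  let := baseStructure hle (V₀ ∪ inLarger hle W₀)
  choose v hvV hv using fun v₀ : V₀ => hV.2 v₀.1 (hV₀.1 v₀.2)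
  choose w₀ hw₀W₀ hw₀ using fun w : W => hW₀.2 w.1 (hW.1 w.2)
  rw [kCompact_iff_kCompactAlong] at hc ⊢
  have compact_V₀ : L.KCompactAlong κ fun (v₀ : V₀) γ => γ ∉ v₀.1 :=
    hc.mono hL hκ hV₀κ (fun v₀ => ⟨v v₀, hvV v₀⟩) id fun v₀ _ hγ hγv₀ => hγ (hv v₀ hγv₀)
  refine (hL.kCompactAlong_of_extensionsRealize hκ ((mk_ord_toType lam).trans_le lam_le)
    card_lang_le hW₀κ hS.extensionsRealize compact_V₀).mono hL hκ hWκ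
    (fun w => ⟨w₀ w, hw₀W₀ w⟩) (Function.invFun (inclOrd hle)) ?_
  rintro w _ ⟨⟨γ, rfl⟩, hγ⟩ hγw
  rw [Function.leftInverse_invFun (inclOrd_injective hle)] at hγw
  exact hγ ⟨γ, hw₀ w hγw, rfl⟩

end AbstractLogic

/-! ### Decomposable ultrafilters -/

section FullLang

variable (X : Type u)

/-- The operation symbols of `fullLang`. -/
inductive FullFn : ℕ → Type u
  | map (f : X → X) : FullFn 1

/-- The relation symbols of `fullLang`. -/
inductive FullRel : ℕ → Type u
  | set (s : Set X) : FullRel 1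

/-- The language with symbols for all self-maps and all subsets of `X`. -/
def fullLang : FirstOrder.Language.{u, u} :=
  ⟨FullFn X, FullRel X⟩

/-- Every symbol denotes the self-map or the subset that it stands for. -/
instance fullStructure : (fullLang X).Structure X where
  funMap | .map f => fun x => f (x 0)
  RelMap | .set s => fun x => x 0 ∈ s

end FullLang

theorem realize_of_forall_realize {K : FirstOrder.Language.{u, u}} {A B : Type u} [K.Structure A]
    [K.Structure B] (e : A ↪ₑ[K] B) (φ : K.Formula (Fin 1)) (h : ∀ a : A, φ.Realize ![a]) (b : B) :
    φ.Realize ![b] := by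
  have eq_cons : ∀ {M : Type u} (a : Fin 1 → M), a = ![a 0] := fun a =>
    funext fun i => by fin_cases i; rfl
  have A_models : A ⊨ (φ.relabel Sum.inr : K.Formula (Empty ⊕ Fin 1)).iAlls := by
    rw [Sentence.Realize, Formula.realize_iAlls]
    intro a
    rw [Formula.realize_relabel, eq_cons (_ ∘ _)]
    exact h _
  have B_models := (e.map_sentence _).1 A_models
  rw [Sentence.Realize, Formula.realize_iAlls] at B_models
  simpa only [Formula.realize_relabel, Sum.elim_comp_inr] using B_models ![b]

section TypeUltrafilter

variable {K : FirstOrder.Language.{u, u}} {A B : Type u} [K.Structure A]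
  [(K.sum (fullLang A)).Structure B]

variable (K) in
/-- The symbol for the subset `s` of `A`, next to the symbols of `K`. -/
def setRel (s : Set A) : (K.sum (fullLang A)).Relations 1 := .inr (.set s)

theorem relMap_setRel_iff (e : A ↪ₑ[K.sum (fullLang A)] B) (x : B) {s : Set A}
    (φ : (K.sum (fullLang A)).Formula (Fin 1)) (hφ : ∀ a : A, φ.Realize ![a] ↔ a ∈ s) :
    RelMap (setRel K s) ![x] ↔ φ.Realize ![x] := by
  have realize_iff := realize_of_forall_realize e (((setRel K s).formula₁ (.var 0)).iff φ)
    (fun a => by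
      rw [Formula.realize_iff, Formula.realize_rel₁]
      exact (hφ a).symm) x
  rwa [Formula.realize_iff, Formula.realize_rel₁] at realize_iff

/-- The ultrafilter of all subsets `s` of `A` such that `x` satisfies the symbol for `s`. -/
def typeUltrafilter (e : A ↪ₑ[K.sum (fullLang A)] B) (x : B) : Ultrafilter A :=
  let isMem (s : Set A) : (K.sum (fullLang A)).Formula (Fin 1) := (setRel K s).formula₁ (.var 0)
  have realize_isMem (s : Set A) : (isMem s).Realize ![x] ↔ RelMap (setRel K s) ![x] :=
    Formula.realize_rel₁
  have realize_isMem_A (s : Set A) (a : A) : (isMem s).Realize ![a] ↔ a ∈ s :=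
    Formula.realize_rel₁
  .ofComplNotMemIff
    { sets := {s | RelMap (setRel K s) ![x]}
      univ_sets := (relMap_setRel_iff e x ⊤ fun _ => by simp).2 (Formula.realize_top.2 trivial)
      sets_of_superset := fun {s t} hs hst =>
        (relMap_setRel_iff e x (isMem s ⊔ isMem t) fun a => by
          simpa [Formula.realize_sup, realize_isMem_A] using @hst a).2
            (Formula.realize_sup.2 (.inl ((realize_isMem s).2 hs)))
      inter_sets := fun {s t} hs ht =>
        (relMap_setRel_iff e x (isMem s ⊓ isMem t) fun a => by
          simp [Formula.realize_inf, realize_isMem_A]).2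
            (Formula.realize_inf.2 ⟨(realize_isMem s).2 hs, (realize_isMem t).2 ht⟩) }
    fun s => by
      have compl_iff := relMap_setRel_iff e x (s := sᶜ) (isMem s).not fun a => by
        simp [Formula.realize_not, realize_isMem_A]
      rw [Formula.realize_not, realize_isMem] at compl_iff
      exact (not_congr compl_iff).trans not_not

theorem mem_typeUltrafilter_iff (e : A ↪ₑ[K.sum (fullLang A)] B) (x : B) {s : Set A}
    (φ : (K.sum (fullLang A)).Formula (Fin 1)) (hφ : ∀ a : A, φ.Realize ![a] ↔ a ∈ s) :
    s ∈ typeUltrafilter e x ↔ φ.Realize ![x] :=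
  relMap_setRel_iff e x φ hφ

end TypeUltrafilter

section Decomposable

variable {κ lam mu : Cardinal.{u}} {V : Set (Set lam.ord.ToType)} {W : Set (Set mu.ord.ToType)}

theorem expansionWitnesses_fullLang (hle : mu ≤ lam)
    (hD : ∀ D : Ultrafilter lam.ord.ToType, UniformOver lam D → Decomposable mu D)
    (hV : CofinalInSmall lam lam V) (hW : W ⊆ SmallSubsets mu mu) :
    ExpansionWitnesses hle V W (fullLang lam.ord.ToType) (fullStructure lam.ord.ToType) := by
  let := baseStructure hle (V ∪ inLarger hle W)
  rintro B _ ⟨e⟩ R Rmem ⟨x, hx⟩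
  let Λ := (baseLang ↥(V ∪ inLarger hle W)).sum (fullLang lam.ord.ToType)
  let baseRel (r : BaseRel ↥(V ∪ inLarger hle W) 1) : Λ.Relations 1 := .inl r
  have uniform : UniformOver lam (typeUltrafilter e x) := by
    refine fun s hs => ((mk_set_le s).trans_eq (mk_ord_toType lam)).eq_of_not_lt fun hlt => ?_
    obtain ⟨v, hv, hsv⟩ := hV.2 s hlt
    have mem_v := (mem_typeUltrafilter_iff e x (s := v) ((baseRel (.mem ⟨v, .inl hv⟩)).formula₁
      (.var 0)) fun a => Formula.realize_rel₁).1 (Filter.mem_of_superset hs hsv)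
    exact hx ⟨v, .inl hv⟩ hv (Formula.realize_rel₁.1 mem_v)
  obtain ⟨f, hf⟩ := hD _ uniform
  let F : Λ.Functions 1 := .inr (.map (inclOrd hle ∘ f))
  have relMap_iff (r : BaseRel ↥(V ∪ inLarger hle W) 1) (s : Set lam.ord.ToType)
      (hs : ∀ a, RelMap (baseRel r) ![inclOrd hle (f a)] ↔ a ∈ s) :
      RelMap (baseRel r) ![funMap F ![x] ] ↔ s ∈ typeUltrafilter e x := by
    rw [mem_typeUltrafilter_iff e x ((baseRel r).formula₁ (F.apply₁ (.var 0))) fun a => ?_]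
    · rw [Formula.realize_rel₁, Term.realize_functions_apply₁]
      rfl
    · rw [Formula.realize_rel₁, Term.realize_functions_apply₁]
      exact hs a
  refine ⟨funMap F ![x], ?_, ?_⟩
  · exact (relMap_iff .R Set.univ fun a => iff_of_true ⟨f a, rfl⟩ trivial).2 Filter.univ_mem
  · rintro ⟨_, hv⟩ ⟨w, hw, rfl⟩ hFx
    have preimage_mem : f ⁻¹' w ∈ typeUltrafilter e x :=
      (relMap_iff (.mem ⟨_, hv⟩) _ fun a => (inclOrd_injective hle).mem_set_image).1 hFx
    exact (hW hw).ne (hf w preimage_mem)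

theorem modelImplies_of_decomposable (hle : mu ≤ lam)
    (hD : ∀ D : Ultrafilter lam.ord.ToType, UniformOver lam D → Decomposable mu D)
    (hV : CofinalInSmall lam lam V) (hVκ : #V ≤ κ) (hW : CofinalInSmall mu mu W) (hWκ : #W ≤ κ)
    (hκ : (fullLang lam.ord.ToType).card ≤ κ) : ModelImplies κ lam mu hle :=
  ⟨V, W, hV, hVκ, hW, hWκ, _, _, hκ, expansionWitnesses_fullLang hle hD hV hW.1⟩

end Decomposable

namespace AbstractLogic

variable {L : AbstractLogic.{u, w}} {lam mu : Cardinal.{u}}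

theorem boxCompact_iff_forall_kCompact {V : Set (Set lam.ord.ToType)} (c : Cardinal.{u}) :
    L.BoxCompact V ↔ ∀ κ, c ≤ κ → L.KCompact κ V := by
  constructor
  · intro h κ _ τ Γ φ hΓ
    obtain ⟨d, -, hd⟩ := le_lift_iff.1 hΓ
    rw [← d.mk_out] at hd
    obtain ⟨e⟩ := lift_mk_eq'.1 hd
    exact h τ Γ φ ⟨_, ⟨e.symm⟩⟩
  · intro h τ Γ φ hΓ
    refine h (max c #(Shrink.{u} Γ)) (le_max_left _ _) τ Γ φ ?_
    rw [lift_mk_eq'.2 ⟨equivShrink.{u} Γ⟩]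
    exact lift_le.2 (le_max_right _ _)

theorem IsRegular.boxCompact_of_decomposable (hL : L.IsRegular) (hmu : ℵ₀ ≤ mu) (hle : mu ≤ lam)
    (hD : ∀ D : Ultrafilter lam.ord.ToType, UniformOver lam D → Decomposable mu D)
    {V : Set (Set lam.ord.ToType)} (hV : CofinalInSmall lam lam V) (hc : L.BoxCompact V)
    {W : Set (Set mu.ord.ToType)} (hW : CofinalInSmall mu mu W) : L.BoxCompact W := by
  let κ₀ := max #V (max #W (fullLang lam.ord.ToType).card)
  refine (boxCompact_iff_forall_kCompact κ₀).2 fun κ hκ => ?_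
  obtain ⟨hVκ, hWκ, hlang⟩ : #V ≤ κ ∧ #W ≤ κ ∧ (fullLang lam.ord.ToType).card ≤ κ := by
    simpa only [κ₀, max_le_iff] using hκ
  exact hL.kCompact_of_modelImplies hmu hle
    (modelImplies_of_decomposable hle hD hV hVκ hW hWκ hlang) hV
    ((boxCompact_iff_forall_kCompact κ₀).1 hc κ hκ) hW hWκ

end AbstractLogic

theorem mainTheorem3 (κ lam mu : Cardinal.{u}) (hmu : ℵ₀ ≤ mu) (hle : mu ≤ lam)
    (hκ : max (cfSmall lam lam) (cfSmall mu mu) ≤ κ) :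
    (ModelImplies κ lam mu hle →
      ∀ L : AbstractLogic.{u, w}, L.IsRegular →
        ∀ V : Set (Set lam.ord.ToType), CofinalInSmall lam lam V → #V ≤ κ → L.KCompact κ V →
        ∀ W : Set (Set mu.ord.ToType), CofinalInSmall mu mu W → #W ≤ κ → L.KCompact κ W) ∧
    ((∀ D : Ultrafilter lam.ord.ToType, UniformOver lam D → Decomposable mu D) →
      ∀ L : AbstractLogic.{u, w}, L.IsRegular →
        ∀ V : Set (Set lam.ord.ToType), CofinalInSmall lam lam V → L.BoxCompact V →
        ∀ W : Set (Set mu.ord.ToType), CofinalInSmall mu mu W → L.BoxCompact W) :=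
  ⟨fun h _ hL _ hV _ hc _ hW hWκ => hL.kCompact_of_modelImplies hmu hle h hV hc hW hWκ,
    fun hD _ hL _ hV hc _ hW => hL.boxCompact_of_decomposable hmu hle hD hV hc hW⟩
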